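/- Let $x\in\mathbb{R}^n$ be a signal, $z_0=0,z_1,\dots,z_J\in\mathbb{R}^n$ side information signals, $\lambda>0$, and let $W_j=\mathrm{diag}(w_{j1},\dots,w_{jn})$, $0\le j\le J$, be diagonal weight matrices with $w_{ji}\ge 0$ and $\sum_j W_j=I_n$. Consider the weighted $n$-$\ell_1$ function $$g(v)=\lambda\sum_{j=0}^{J}\|W_j(v-z_j)\|_1 .$$ For $\gamma\sim\mathcal N(0,I_n)$ put $U_g=\inf_{\tau\ge 0}\mathbb{E}\big[\mathrm{dist}^2(\gamma,\tau\cdot\partial g(x))\big]$, where $\partial g$ is the subdifferential; for a cone $C$ with polar cone $C^\circ$ put $\delta(C)=\mathbb{E}[\mathrm{dist}^2(\gamma,C^\circ)]$; let $\mathcal D(g,x)=\{y:\exists\,\tau>0,\ g(x+\tau y)\le g(x)\}$ be the descent cone. A number $m$ of measurements satisfies the measurement condition for recovering $x$ if $m\ge U_g+1$, respectively $m\ge\delta(\mathcal D(g,x))+1$. Let $P$ be the set of positions $i$ at which every difference $x_i-z_{ji}$ with $w_{ji}\neq0$ is nonzero, $M$ the set of positions at which some but not all of the differences $x_i-z_{ji}$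 with $w_{ji}\ne 0$ vanish, and $p=|P|$. With $a_i=\sum_j w_{ji}\,\mathrm{sign}(x_i-z_{ji})$ and $c_i=\sum_{j:\,x_i=z_{ji}}w_{ji}$ let $$\bar a=\sum_{i\in P}a_i^2,\qquad \bar s=p+\sum_{i\in M}(1-c_i),\qquad \delta=(\kappa-1)(\bar s-p),\qquad \kappa=\frac{\sqrt4\,\min_{M}c_i}{\sqrt{\pi\log(n/\bar s)}\,(2\min_{M}c_i-1)},$$ with $\delta:=0$ if $M=\emptyset$. The weighted $n$-$\ell_1$ bound is $m\ge 2\bar a\log\frac n{\bar s}+\frac75\bar s+\delta+1$. Let $s_0=\|x\|_0$, $s_1=\|x-z_1\|_0$, where $\|\cdot\|_0$ counts the nonzero entries. (a) Let $W_0=I_n$ and $W_j=0$ for $1\le j\le J$, and let $s_0>0$. Then $g(v)=\lambda\|v\|_1$, $\bar a=\bar s=s_0$ and $\delta=0$, so that the weighted $n$-$\ell_1$ bound becomes the $\ell_1$ bound $$m\ \ge\ 2s_0\log\frac{n}{s_0}+\frac75 s_0+1 .$$ The right-hand side is at least $U_g+1$, and every $m\in\mathbb{N}$ satisfying this bound satisfies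 $m\ge U_g+1$ and $m\ge\delta(\mathcal D(g,x))+1$. (b) Let $J\ge1$, $W_0=W_1=\frac12I_n$ and $W_j=0$ for $2\le j\le J$, and let $s_0+s_1>0$. Then $g(v)=\frac\lambda2(\|v\|_1+\|v-z_1\|_1)$, $\bar a=\bar h$ and $\bar s=\frac{s_0+s_1}2=s_0+\frac\xi2$, where $$\bar h=|\{i:x_i>0,\ x_i>z_{1i}\}\cup\{i:x_i<0,\ x_i<z_{1i}\}|,\qquad \xi=|\{i:z_{1i}\ne x_i=0\}|-|\{i:z_{1i}=x_i\neq0\}| ,$$ and the bound becomes, with no $\delta$ term (the expression for $\kappa$ is undefined when $M\neq\emptyset$, since then $c_i=\frac12$ on $M$), the $\ell_1$-$\ell_1$ bound $$m\ \ge\ 2\bar h\log\frac{n}{\bar s}+\frac75\bar s+1 .$$ The right-hand side is at least $U_g+1$, and every $m\in\mathbb{N}$ satisfying this bound satisfies $m\ge U_g+1$ and $m\ge\delta(\mathcal D(g,x))+1$. -/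

import Mathlib

open scoped ENNReal Pointwise

namespace NL1

noncomputable section

/-- Signals in `ℝⁿ`, with the Euclidean norm. -/
abbrev Signal (n : ℕ) : Type := EuclideanSpace ℝ (Fin n)

section Recovery

variable {n : ℕ}

/-- The subdifferential `∂g(x)` of a function `g : ℝⁿ → ℝ`. -/
def subdifferential (g : Signal n → ℝ) (x : Signal n) : Set (Signal n) :=
  {u | ∀ y, g x + inner ℝ u (y - x) ≤ g y}

/-- The descent cone of `g` at `x`: the directions along which some positive step does not
increase `g`. -/
def descentCone (g : Signal n → ℝ) (x : Signal n) : Set (Signal n) :=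
  {y | ∃ τ : ℝ, 0 < τ ∧ g (x + τ • y) ≤ g x}

/-- The polar cone: the outward normals of `C`. -/
def polarCone (C : Set (Signal n)) : Set (Signal n) :=
  {u | ∀ y ∈ C, inner ℝ u y ≤ 0}

/-- `E[dist²(γ, S)]` for a standard normal vector `γ ∼ N(0, Iₙ)`, as an element of `[0, ∞]`. -/
def expSqDist (S : Set (Signal n)) : ℝ≥0∞ :=
  ∫⁻ γ, Metric.infEDist γ S ^ 2 ∂(ProbabilityTheory.stdGaussian (Signal n))

/-- The statistical dimension of a cone, `E[dist²(γ, C°)]`. -/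
def statDim (C : Set (Signal n)) : ℝ≥0∞ := expSqDist (polarCone C)

/-- `U_g = inf_{τ ≥ 0} E[dist²(γ, τ · ∂g(x))]`. -/
def measurementU (g : Signal n → ℝ) (x : Signal n) : ℝ≥0∞ :=
  ⨅ (τ : ℝ) (_ : 0 ≤ τ), expSqDist (τ • subdifferential g x)

end Recovery

section Signals

variable {n : ℕ}

/-- The number of nonzero entries, `‖v‖₀`. -/
def nnz (v : Signal n) : ℕ := (Finset.univ.filter fun i => v i ≠ 0).card

/-- `ξ = |{i : z_i ≠ x_i = 0}| - |{i : z_i = x_i ≠ 0}|`. -/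
def xi (x z : Signal n) : ℤ :=
  ((Finset.univ.filter fun i => z i ≠ x i ∧ x i = 0).card : ℤ)
    - ((Finset.univ.filter fun i => z i = x i ∧ x i ≠ 0).card : ℤ)

/-- `h̄ = |{i : x_i > 0, x_i > z_i} ∪ {i : x_i < 0, x_i < z_i}|`. -/
def hbar (x z : Signal n) : ℕ :=
  ((Finset.univ.filter fun i => 0 < x i ∧ z i < x i)
    ∪ (Finset.univ.filter fun i => x i < 0 ∧ x i < z i)).card

/-- The `ℓ₁`-norm of a vector of `ℝⁿ`. -/
def l1Norm (v : Fin n → ℝ) : ℝ := ∑ i, |v i|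

end Signals

section Weighted

variable {n J : ℕ}

/-- The weighted `n`-`ℓ₁` function `g(v) = λ ∑_{j=0}^J ‖W_j (v - z_j)‖₁`
(with `lam` in the role of `λ`). -/
def nL1 (lam : ℝ) (W : Fin (J + 1) → Matrix (Fin n) (Fin n) ℝ) (z : Fin (J + 1) → Signal n)
    (v : Signal n) : ℝ :=
  lam * ∑ j, l1Norm (Matrix.mulVec (W j) fun i => v i - z j i)

/-- The first group of positions (`1, …, p` after rearrangement): all the differences
`x_i - z_{ji}` that carry a nonzero weight are nonzero. -/
def firstGroup (W : Fin (J + 1) → Matrix (Fin n) (Fin n) ℝ) (x : Signal n)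
    (z : Fin (J + 1) → Signal n) : Finset (Fin n) :=
  Finset.univ.filter fun i => ∀ j, W j i i ≠ 0 → x i ≠ z j i

/-- The middle group of positions (`p + 1, …, q` after rearrangement): among the differences
`x_i - z_{ji}` that carry a nonzero weight, at least one is zero and at least one is nonzero. -/
def middleGroup (W : Fin (J + 1) → Matrix (Fin n) (Fin n) ℝ) (x : Signal n)
    (z : Fin (J + 1) → Signal n) : Finset (Fin n) :=
  Finset.univ.filter fun i =>
    (∃ j, W j i i ≠ 0 ∧ x i = z j i) ∧ (∃ j, W j i i ≠ 0 ∧ x i ≠ z j i)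

/-- `a_i = ∑_j w_{ji} sign(x_i - z_{ji})`. -/
def aCoef (W : Fin (J + 1) → Matrix (Fin n) (Fin n) ℝ) (x : Signal n)
    (z : Fin (J + 1) → Signal n) (i : Fin n) : ℝ :=
  ∑ j, W j i i * Real.sign (x i - z j i)

/-- `c_i`: the total weight of the differences that vanish at position `i`. -/
def cCoef (W : Fin (J + 1) → Matrix (Fin n) (Fin n) ℝ) (x : Signal n)
    (z : Fin (J + 1) → Signal n) (i : Fin n) : ℝ :=
  ∑ j, if x i = z j i then W j i i else 0

/-- `ā = ∑_{i ≤ p} a_i²`. -/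
def aBar (W : Fin (J + 1) → Matrix (Fin n) (Fin n) ℝ) (x : Signal n)
    (z : Fin (J + 1) → Signal n) : ℝ :=
  ∑ i ∈ firstGroup W x z, aCoef W x z i ^ 2

/-- `s̄ = p + ∑_{p < i ≤ q} (1 - c_i)`. -/
def sBar (W : Fin (J + 1) → Matrix (Fin n) (Fin n) ℝ) (x : Signal n)
    (z : Fin (J + 1) → Signal n) : ℝ :=
  ((firstGroup W x z).card : ℝ) + ∑ i ∈ middleGroup W x z, (1 - cCoef W x z i)

/-- `min c_i` over the middle group. -/
def minC (W : Fin (J + 1) → Matrix (Fin n) (Fin n) ℝ) (x : Signal n)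
    (z : Fin (J + 1) → Signal n) : ℝ :=
  ⨅ i : {i // i ∈ middleGroup W x z}, cCoef W x z i

/-- `κ = √4 · min c_i / (√(π log(n / s̄)) (2 min c_i - 1))`. -/
def kappa (W : Fin (J + 1) → Matrix (Fin n) (Fin n) ℝ) (x : Signal n)
    (z : Fin (J + 1) → Signal n) : ℝ :=
  √4 * minC W x z / (√(Real.pi * Real.log (n / sBar W x z)) * (2 * minC W x z - 1))

/-- `δ = (κ - 1)(s̄ - p)`. -/
def delta (W : Fin (J + 1) → Matrix (Fin n) (Fin n) ℝ) (x : Signal n)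
    (z : Fin (J + 1) → Signal n) : ℝ :=
  (kappa W x z - 1) * (sBar W x z - ((firstGroup W x z).card : ℝ))

/-- The weighted `n`-`ℓ₁` measurement bound `2 ā log(n / s̄) + (7/5) s̄ + δ + 1`. -/
def nL1Bound (W : Fin (J + 1) → Matrix (Fin n) (Fin n) ℝ) (x : Signal n)
    (z : Fin (J + 1) → Signal n) : ℝ :=
  2 * aBar W x z * Real.log (n / sBar W x z) + 7 / 5 * sBar W x z + delta W x z + 1

end Weighted

/-- The `ℓ₁` measurement bound `2 s₀ log(n / s₀) + (7/5) s₀ + 1`. -/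
def l1Bound {n : ℕ} (x : Signal n) : ℝ :=
  2 * (nnz x : ℝ) * Real.log (n / (nnz x : ℝ)) + 7 / 5 * (nnz x : ℝ) + 1

/-- The `ℓ₁`-`ℓ₁` measurement bound `2 h̄ log(n / (s₀ + ξ/2)) + (7/5)(s₀ + ξ/2) + 1`. -/
def l1l1Bound {n : ℕ} (x z : Signal n) : ℝ :=
  2 * (hbar x z : ℝ) * Real.log (n / ((nnz x : ℝ) + (xi x z : ℝ) / 2))
    + 7 / 5 * ((nnz x : ℝ) + (xi x z : ℝ) / 2) + 1

end

end NL1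

open NL1

/-!
The `ℓ₁` function is the `ℓ₁`-`ℓ₁` function `g(v) = λ/2 (‖v‖₁ + ‖v - z‖₁)` with `z = 0`, so one
estimate covers both choices of weights.

The subdifferential of `g` at `x` contains `λ` times a box, whose `i`-th side runs from the left to
the right derivative of `v ↦ (|v| + |v - z i|) / 2` at `x i` (`mem_subdifferential_l1l1`). For
`t ≥ 0`, the choice `τ = t / λ` in the infimum defining `U_g` therefore leaves the expected squared
distance of `γ` to `t` times the box. That distance splits into coordinates, each of which is a
sum of two values of `E[(γ - b)₊²]` (`expSqDist_le_of_box_subset`). By the symmetry of the Gaussian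
these add up exactly (`sum_excess_slopes`) to
`s + h̄ t² + (n - s) · 2 E[(γ - t)₊²]`, with `s = (‖x‖₀ + ‖x - z‖₀) / 2`.

At `t = √(2 log (n / s))` the middle term is `2 h̄ log (n / s)`. The last one is at most `2 s / 5`
(`sub_mul_gaussianExcess_le`), by the tail bound `E[(γ - t)₊²] ≤ (3/4) φ(t) / t` with `φ` the
Gaussian density, and an elementary inequality for `1 - exp (-u)` at `u = log (n / s)`. Finally,
multiples of subgradients lie in the polar of the descent cone, so that the statistical dimension
is at most `U_g` (`statDim_descentCone_le_measurementU`). The remaining identities count entries.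
-/

namespace NL1

open MeasureTheory ProbabilityTheory

/-! ### The mean square excess of a Gaussian variable -/

/-- The mean square excess `E[(γ - b)₊²]` of a standard normal variable over the level `b`. -/
noncomputable def gaussianExcess (b : ℝ) : ℝ :=
  ∫ u, max (u - b) 0 ^ 2 ∂gaussianReal 0 1

theorem integrable_sub_sq (b : ℝ) :
    Integrable (fun u : ℝ => (u - b) ^ 2) (gaussianReal 0 1) :=
  ((memLp_id_gaussianReal' (μ := 0) (v := 1) 2 (by simp)).sub (memLp_const b)).integrable_sq

theorem integrable_excess (b : ℝ) :
    Integrable (fun u : ℝ => max (u - b) 0 ^ 2) (gaussianReal 0 1) := by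
  refine (integrable_sub_sq b).mono' (by fun_prop) (ae_of_all _ fun u => ?_)
  rw [Real.norm_eq_abs, abs_of_nonneg (sq_nonneg _)]
  rcases le_total (u - b) 0 with h | h
  · rw [max_eq_right h, zero_pow two_ne_zero]; exact sq_nonneg _
  · rw [max_eq_left h]

theorem measurePreserving_neg_gaussianReal :
    MeasurePreserving (fun u : ℝ => -u) (gaussianReal 0 1) (gaussianReal 0 1) :=
  ⟨measurable_neg, by rw [gaussianReal_map_neg, neg_zero]⟩

theorem integrable_deficit (b : ℝ) :
    Integrable (fun u : ℝ => max (b - u) 0 ^ 2) (gaussianReal 0 1) := by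
  have h := measurePreserving_neg_gaussianReal.integrable_comp_of_integrable
    (integrable_excess (-b))
  refine h.congr (ae_of_all _ fun u => ?_)
  simp [sub_eq_add_neg, add_comm]

theorem integral_deficit (b : ℝ) :
    ∫ u, max (b - u) 0 ^ 2 ∂gaussianReal 0 1 = gaussianExcess (-b) := by
  rw [gaussianExcess, ← measurePreserving_neg_gaussianReal.integral_comp
    (MeasurableEquiv.neg ℝ).measurableEmbedding]
  refine integral_congr_ae (ae_of_all _ fun u => ?_)
  simp [sub_eq_add_neg, add_comm]

theorem gaussianExcess_add_neg (b : ℝ) : gaussianExcess b + gaussianExcess (-b) = 1 + b ^ 2 := by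
  rw [← integral_deficit, gaussianExcess, ← integral_add (integrable_excess b)
    (integrable_deficit b)]
  have h1 : ∫ u : ℝ, u ∂gaussianReal 0 1 = 0 := integral_id_gaussianReal
  have h2 : ∫ u : ℝ, u ^ 2 ∂gaussianReal 0 1 = 1 := by
    have h := variance_id_gaussianReal (μ := 0) (v := 1)
    rw [variance_of_integral_eq_zero (by fun_prop) (by simp)] at h
    simpa using h
  have i1 : Integrable (fun u : ℝ => u) (gaussianReal 0 1) :=
    (memLp_id_gaussianReal' (μ := 0) (v := 1) 1 (by simp)).integrable le_rfl
  have i2 : Integrable (fun u : ℝ => u ^ 2) (gaussianReal 0 1) := by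
    simpa using integrable_sub_sq 0
  calc ∫ u, (max (u - b) 0 ^ 2 + max (b - u) 0 ^ 2) ∂gaussianReal 0 1
      = ∫ u, (u ^ 2 - 2 * b * u + b ^ 2) ∂gaussianReal 0 1 := by
        refine integral_congr_ae (ae_of_all _ fun u => ?_)
        simp only
        rcases le_total u b with h | h
        · rw [max_eq_right (by linarith), max_eq_left (by linarith)]; ring
        · rw [max_eq_left (by linarith), max_eq_right (by linarith)]; ring
    _ = 1 + b ^ 2 := by
        have i3 : Integrable (fun u : ℝ => u ^ 2 - 2 * b * u) (gaussianReal 0 1) :=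
          i2.sub (i1.const_mul _)
        rw [integral_add i3 (integrable_const _),
          integral_sub i2 (i1.const_mul _), integral_const_mul, h1, h2]
        simp

theorem gaussianExcess_zero : gaussianExcess 0 = 1 / 2 := by
  have h := gaussianExcess_add_neg 0
  rw [neg_zero] at h
  linarith

/-- A tail bound for the mean square excess. With `u = t + v` the integrand is
`v² exp(-v²/2) · φ(t) exp(-tv)`, whose first factor is at most `2 / e ≤ 3 / 4`. -/
theorem gaussianExcess_le {t : ℝ} (ht : 0 < t) :
    gaussianExcess t ≤ 3 / 4 * (√(2 * Real.pi))⁻¹ * Real.exp (-t ^ 2 / 2) / t := by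
  have hpdf : ∀ u : ℝ, gaussianPDFReal 0 1 u = (√(2 * Real.pi))⁻¹ * Real.exp (-u ^ 2 / 2) := by
    intro u; simp [gaussianPDFReal]
  have hv : ∀ v : ℝ, v ^ 2 * Real.exp (-v ^ 2 / 2) ≤ 3 / 4 := by
    intro v
    have h1 := Real.add_one_le_exp (v ^ 2 / 2 - 1)
    have h2 : Real.exp (v ^ 2 / 2 - 1) * Real.exp 1 * Real.exp (-v ^ 2 / 2) = 1 := by
      rw [← Real.exp_add, ← Real.exp_add, ← Real.exp_zero]; ring_nf
    have h3 := Real.exp_one_gt_d9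
    have h4 := Real.exp_pos (-v ^ 2 / 2)
    have h5 := Real.exp_pos (v ^ 2 / 2 - 1)
    have h6 : v ^ 2 ≤ 3 / 4 * (Real.exp (v ^ 2 / 2 - 1) * Real.exp 1) := by nlinarith
    calc v ^ 2 * Real.exp (-v ^ 2 / 2)
        ≤ 3 / 4 * (Real.exp (v ^ 2 / 2 - 1) * Real.exp 1) * Real.exp (-v ^ 2 / 2) := by gcongr
      _ = 3 / 4 := by rw [mul_assoc, h2, mul_one]
  have hc : 0 ≤ (√(2 * Real.pi))⁻¹ := by positivity
  have hint : IntegrableOn (fun u => 3 / 4 * (√(2 * Real.pi))⁻¹ * Real.exp (t ^ 2 / 2) *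
      Real.exp (-t * u)) (Set.Ioi t) :=
    (integrableOn_exp_mul_Ioi (neg_lt_zero.2 ht) t).const_mul _
  rw [gaussianExcess, integral_gaussianReal_eq_integral_smul one_ne_zero]
  calc ∫ u, gaussianPDFReal 0 1 u • max (u - t) 0 ^ 2
      ≤ ∫ u, (Set.Ioi t).indicator (fun u => 3 / 4 * (√(2 * Real.pi))⁻¹ *
          Real.exp (t ^ 2 / 2) * Real.exp (-t * u)) u := by
        refine integral_mono_of_nonneg (ae_of_all _ fun u => ?_)
          ((integrable_indicator_iff measurableSet_Ioi).2 hint) (ae_of_all _ fun u => ?_)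
        · exact mul_nonneg (gaussianPDFReal_nonneg _ _ _) (by positivity)
        · simp only [smul_eq_mul]
          by_cases hu : t < u
          · rw [Set.indicator_of_mem (Set.mem_Ioi.2 hu), max_eq_left (by linarith), hpdf]
            have : Real.exp (-u ^ 2 / 2) = Real.exp (-(u - t) ^ 2 / 2) *
                (Real.exp (t ^ 2 / 2) * Real.exp (-t * u)) := by
              rw [← Real.exp_add, ← Real.exp_add]; ring_nf
            rw [this]
            have h := mul_le_mul_of_nonneg_right (hv (u - t)) (mul_nonneg hc
              (mul_nonneg (Real.exp_nonneg (t ^ 2 / 2)) (Real.exp_nonneg (-t * u))))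
            linarith
          · rw [Set.indicator_of_notMem (by simpa using hu), max_eq_right (by linarith)]
            simp
    _ = 3 / 4 * (√(2 * Real.pi))⁻¹ * Real.exp (-t ^ 2 / 2) / t := by
        rw [integral_indicator measurableSet_Ioi, integral_const_mul,
          integral_exp_mul_Ioi (neg_lt_zero.2 ht)]
        have : Real.exp (-t ^ 2 / 2) = Real.exp (t ^ 2 / 2) * Real.exp (-t * t) := by
          rw [← Real.exp_add]; ring_nf
        rw [this]
        field_simp

/-- The numerical inequality behind the constant `7 / 5`. -/
theorem sq_one_sub_exp_neg_le {u : ℝ} (hu : 0 ≤ u) :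
    (1 - Real.exp (-u)) ^ 2 ≤ 89 / 100 * u := by
  have h1 := Real.add_one_le_exp (-u)
  have h0 := Real.exp_pos (-u)
  have h2 : Real.exp (-u) ≤ 1 := Real.exp_le_one_iff.2 (by linarith)
  rcases le_total u (89 / 100) with h | h
  · nlinarith
  rcases le_total 2 u with h' | h'
  · nlinarith
  -- here `exp (-u) ≥ exp (-2) ≥ 1 / 9`, and `(8 / 9)² ≤ 0.89²`
  have h3 : 1 / 9 ≤ Real.exp (-u) := by
    have h4 : Real.exp 2 ≤ 9 := by
      have : Real.exp 2 = Real.exp 1 * Real.exp 1 := by rw [← Real.exp_add]; norm_num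
      have := Real.exp_one_lt_three
      have := Real.exp_pos 1
      nlinarith
    calc (1 / 9 : ℝ) ≤ 1 / Real.exp 2 := one_div_le_one_div_of_le (Real.exp_pos _) h4
      _ = Real.exp (-2) := by rw [Real.exp_neg, one_div]
      _ ≤ Real.exp (-u) := Real.exp_le_exp.2 (by linarith)
  nlinarith

/-- At the level `t = √(2 log (n / s))` the Gaussian excess outside the support costs at most
`2 / 5` of the effective sparsity `s`. -/
theorem sub_mul_gaussianExcess_le {n s : ℝ} (hs : 0 < s) (hsn : s ≤ n) :
    (n - s) * (2 * gaussianExcess (√(2 * Real.log (n / s)))) ≤ 2 / 5 * s := by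
  rcases hsn.eq_or_lt with rfl | hlt
  · simp; positivity
  set u := Real.log (n / s) with hu
  have hu0 : 0 < u := Real.log_pos ((one_lt_div hs).2 hlt)
  have ht : 0 < √(2 * u) := by positivity
  have hexp : Real.exp (-u) = s / n := by
    rw [Real.exp_neg, hu, Real.exp_log (div_pos (hs.trans hlt) hs), inv_div]
  have hE := gaussianExcess_le ht
  have hn : 0 < n := hs.trans hlt
  have hsq : √(2 * u) ^ 2 = 2 * u := Real.sq_sqrt (by positivity)
  rw [hsq, show -(2 * u) / 2 = -u by ring] at hE
  have hroot : √(2 * Real.pi) * √(2 * u) = 2 * √(Real.pi * u) := by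
    rw [← Real.sqrt_mul (by positivity), show 2 * Real.pi * (2 * u) = 2 ^ 2 * (Real.pi * u) by ring,
      Real.sqrt_mul (by positivity), Real.sqrt_sq (by norm_num)]
  have hr : 0 < √(Real.pi * u) := Real.sqrt_pos.2 (mul_pos Real.pi_pos hu0)
  have hE' : gaussianExcess (√(2 * u)) ≤ 3 / 8 * (s / n) / √(Real.pi * u) := by
    refine hE.trans_eq ?_
    rw [← hexp]
    calc _ = 3 / 4 * Real.exp (-u) / (√(2 * Real.pi) * √(2 * u)) := by field_simp
      _ = _ := by rw [hroot]; field_simp; norm_num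
  have hkey : 1 - s / n ≤ 8 / 15 * √(Real.pi * u) := by
    rw [← hexp]
    refine le_of_sq_le_sq ?_ (by positivity)
    rw [mul_pow, Real.sq_sqrt (by positivity)]
    have := sq_one_sub_exp_neg_le hu0.le
    have := Real.pi_gt_d2
    nlinarith
  calc (n - s) * (2 * gaussianExcess (√(2 * u)))
      ≤ (n - s) * (2 * (3 / 8 * (s / n) / √(Real.pi * u))) := by
        gcongr
    _ = 3 / 4 * s * ((1 - s / n) / √(Real.pi * u)) := by field_simp; norm_num
    _ ≤ 3 / 4 * s * (8 / 15) := by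
        exact mul_le_mul_of_nonneg_left ((div_le_iff₀ hr).2 hkey) (by positivity)
    _ = 2 / 5 * s := by ring

/-! ### The expected squared distance to a box -/

variable {n : ℕ}

theorem measurePreserving_eval_stdGaussian (i : Fin n) :
    MeasurePreserving (fun γ : Signal n => γ i) (stdGaussian (Signal n)) (gaussianReal 0 1) := by
  have h := measurePreserving_eval_multivariateGaussian (μ := (0 : Signal n))
    (S := (1 : Matrix (Fin n) (Fin n) ℝ)) Matrix.PosSemidef.one (i := i)
  simpa using h

/-- The squared distance to a box is bounded coordinate by coordinate: the excess over the upper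
end and the excess of `-γ i` over minus the lower end. -/
theorem expSqDist_le_of_box_subset {S : Set (Signal n)} {l r : Fin n → ℝ} (hlr : ∀ i, l i ≤ r i)
    (hS : ∀ u : Signal n, (∀ i, l i ≤ u i ∧ u i ≤ r i) → u ∈ S) :
    expSqDist S ≤ ENNReal.ofReal (∑ i, (gaussianExcess (r i) + gaussianExcess (-l i))) := by
  have hr : ∀ i, Integrable (fun γ : Signal n => max (γ i - r i) 0 ^ 2)
      (stdGaussian (Signal n)) := fun i =>
    (measurePreserving_eval_stdGaussian i).integrable_comp_of_integrable (integrable_excess (r i))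
  have hl : ∀ i, Integrable (fun γ : Signal n => max (l i - γ i) 0 ^ 2)
      (stdGaussian (Signal n)) := fun i =>
    (measurePreserving_eval_stdGaussian i).integrable_comp_of_integrable (integrable_deficit (l i))
  have hmap : ∀ (i : Fin n) (f : ℝ → ℝ), Measurable f →
      ∫ γ : Signal n, f (γ i) ∂stdGaussian (Signal n) = ∫ u, f u ∂gaussianReal 0 1 := by
    intro i f hf
    rw [← (measurePreserving_eval_stdGaussian i).map_eq,
      integral_map (measurePreserving_eval_stdGaussian i).measurable.aemeasurable
        hf.aestronglyMeasurable]
  have hpt : ∀ γ : Signal n, Metric.infEDist γ S ^ 2 ≤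
      ENNReal.ofReal (∑ i, (max (γ i - r i) 0 ^ 2 + max (l i - γ i) 0 ^ 2)) := by
    intro γ
    let π : Signal n := WithLp.toLp 2 fun i => max (l i) (min (γ i) (r i))
    have hπ : π ∈ S := hS π fun i =>
      ⟨le_max_left _ _, max_le (hlr i) (min_le_right _ _)⟩
    calc Metric.infEDist γ S ^ 2 ≤ edist γ π ^ 2 := by
          gcongr; exact Metric.infEDist_le_edist_of_mem hπ
      _ = ENNReal.ofReal (dist γ π ^ 2) := by
          rw [edist_dist, ENNReal.ofReal_pow dist_nonneg]
      _ = _ := by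
          congr 1
          rw [EuclideanSpace.dist_eq, Real.sq_sqrt (by positivity)]
          refine Finset.sum_congr rfl fun i _ => ?_
          rw [Real.dist_eq, sq_abs]
          change (γ i - max (l i) (min (γ i) (r i))) ^ 2 = _
          have := hlr i
          rcases le_total (γ i) (r i) with h1 | h1 <;> rcases le_total (l i) (γ i) with h2 | h2
          · rw [min_eq_left h1, max_eq_right h2, max_eq_right (by linarith),
              max_eq_right (by linarith)]; ring
          · rw [min_eq_left h1, max_eq_left h2, max_eq_right (by linarith),
              max_eq_left (by linarith)]; ring
          · rw [min_eq_right h1, max_eq_right this, max_eq_left (by linarith),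
              max_eq_right (by linarith)]; ring
          · have e1 : γ i = r i := by linarith
            have e2 : l i = r i := by linarith
            simp [e1, e2]
  calc expSqDist S
      ≤ ∫⁻ γ : Signal n, ENNReal.ofReal (∑ i, (max (γ i - r i) 0 ^ 2 + max (l i - γ i) 0 ^ 2))
          ∂stdGaussian (Signal n) := lintegral_mono hpt
    _ = ENNReal.ofReal (∫ γ : Signal n, ∑ i, (max (γ i - r i) 0 ^ 2 + max (l i - γ i) 0 ^ 2)
          ∂stdGaussian (Signal n)) := by
        rw [ofReal_integral_eq_lintegral_ofReal]
        · exact integrable_finsetSum _ fun i _ => (hr i).add (hl i)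
        · exact ae_of_all _ fun γ => by positivity
    _ = _ := by
        congr 1
        rw [integral_finsetSum Finset.univ (f := fun i (γ : Signal n) =>
          max (γ i - r i) 0 ^ 2 + max (l i - γ i) 0 ^ 2) fun i _ => (hr i).add (hl i)]
        refine Finset.sum_congr rfl fun i _ => ?_
        rw [integral_add (hr i) (hl i), hmap i (fun u => max (u - r i) 0 ^ 2) (by fun_prop),
          hmap i (fun u => max (l i - u) 0 ^ 2) (by fun_prop), integral_deficit]
        rfl

/-! ### Subgradients of the `ℓ₁`-`ℓ₁` function -/

/-- Nonnegative multiples of subgradients are normal to the descent cone, so the statistical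
dimension of the latter is at most `U_g`. -/
theorem statDim_descentCone_le_measurementU (g : Signal n → ℝ) (x : Signal n) :
    statDim (descentCone g x) ≤ measurementU g x := by
  refine le_iInf₂ fun τ hτ => lintegral_mono fun γ => ?_
  refine pow_le_pow_left' (M := ℝ≥0∞) (Metric.infEDist_anti ?_) 2
  rintro _ ⟨u, hu, rfl⟩ y ⟨σ, hσ, hy⟩
  have h := hu (x + σ • y)
  rw [add_sub_cancel_left, real_inner_smul_right] at h
  have h' : inner ℝ u y ≤ 0 := by
    by_contra! hpos
    have := mul_pos hσ hpos
    linarith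
  change inner ℝ (τ • u) y ≤ 0
  rw [real_inner_smul_left]
  exact mul_nonpos_of_nonneg_of_nonpos hτ h'

/-- The left derivative of the absolute value. -/
noncomputable def leftSign (r : ℝ) : ℝ := if 0 < r then 1 else -1

/-- The right derivative of the absolute value. -/
noncomputable def rightSign (r : ℝ) : ℝ := if r < 0 then -1 else 1

theorem leftSign_le_rightSign (r : ℝ) : leftSign r ≤ rightSign r := by
  unfold leftSign rightSign
  split_ifs <;> linarith

theorem abs_add_rightSign_mul_le (r s : ℝ) : |r| + rightSign r * (s - r) ≤ |s| := by
  unfold rightSign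
  split_ifs with hr
  · rw [abs_of_neg hr]; linarith [neg_abs_le s]
  · rw [abs_of_nonneg (not_lt.1 hr)]; linarith [le_abs_self s]

theorem abs_add_leftSign_mul_le (r s : ℝ) : |r| + leftSign r * (s - r) ≤ |s| := by
  unfold leftSign
  split_ifs with hr
  · rw [abs_of_pos hr]; linarith [le_abs_self s]
  · rw [abs_of_nonpos (not_lt.1 hr)]; linarith [neg_abs_le s]

/-- The left derivative of `v ↦ (|v| + |v - b|) / 2` at `a`. -/
noncomputable def lowerSlope (a b : ℝ) : ℝ := (leftSign a + leftSign (a - b)) / 2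

/-- The right derivative of `v ↦ (|v| + |v - b|) / 2` at `a`. -/
noncomputable def upperSlope (a b : ℝ) : ℝ := (rightSign a + rightSign (a - b)) / 2

theorem lowerSlope_le_upperSlope (a b : ℝ) : lowerSlope a b ≤ upperSlope a b := by
  unfold lowerSlope upperSlope
  linarith [leftSign_le_rightSign a, leftSign_le_rightSign (a - b)]

theorem subgradient_of_mem_slopes {a b u : ℝ} (hl : lowerSlope a b ≤ u) (hr : u ≤ upperSlope a b)
    (y : ℝ) : |a| + |a - b| + 2 * (u * (y - a)) ≤ |y| + |y - b| := by
  unfold lowerSlope at hl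
  unfold upperSlope at hr
  rcases le_total a y with h | h
  · have h1 := abs_add_rightSign_mul_le a y
    have h2 := abs_add_rightSign_mul_le (a - b) (y - b)
    have h3 := mul_le_mul_of_nonneg_right hr (sub_nonneg.2 h)
    rw [show y - b - (a - b) = y - a by ring] at h2
    linarith
  · have h1 := abs_add_leftSign_mul_le a y
    have h2 := abs_add_leftSign_mul_le (a - b) (y - b)
    have h3 := mul_le_mul_of_nonneg_right hl (sub_nonneg.2 h)
    rw [show y - b - (a - b) = y - a by ring] at h2
    linarith

/-- The `ℓ₁`-`ℓ₁` function `v ↦ λ/2 (‖v‖₁ + ‖v - z‖₁)`. -/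
noncomputable def l1l1 (lam : ℝ) (z v : Signal n) : ℝ :=
  lam / 2 * (l1Norm v + l1Norm (v - z))

theorem mem_subdifferential_l1l1 {lam : ℝ} (hlam : 0 < lam) {x z u : Signal n}
    (hu : ∀ i, lam * lowerSlope (x i) (z i) ≤ u i ∧ u i ≤ lam * upperSlope (x i) (z i)) :
    u ∈ subdifferential (l1l1 lam z) x := by
  intro y
  have hi : ∀ i, lam / 2 * (|x i| + |x i - z i|) + u i * (y i - x i) ≤
      lam / 2 * (|y i| + |y i - z i|) := by
    intro i
    have h := subgradient_of_mem_slopes (u := u i / lam)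
      ((le_div_iff₀ hlam).2 (by linarith [(hu i).1]))
      ((div_le_iff₀ hlam).2 (by linarith [(hu i).2])) (y i)
    have h2 := mul_le_mul_of_nonneg_left h (half_pos hlam).le
    have h3 : lam / 2 * (2 * (u i / lam * (y i - x i))) = u i * (y i - x i) := by field_simp
    linarith
  have h := Finset.sum_le_sum fun i (_ : i ∈ Finset.univ) => hi i
  have hin : inner ℝ u (y - x) = ∑ i, u i * (y i - x i) := by
    simp [PiLp.inner_apply, mul_comm]
  rw [hin]
  simpa [l1l1, l1Norm, Finset.sum_add_distrib, Finset.mul_sum, mul_add] using h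

/-- At scale `t / λ` the multiples of subgradients fill the box of slopes scaled by `t`, so this
scale bounds `U_g`. -/
theorem measurementU_l1l1_le {lam : ℝ} (hlam : 0 < lam) (x z : Signal n) {t : ℝ} (ht : 0 ≤ t) :
    measurementU (l1l1 lam z) x ≤ ENNReal.ofReal (∑ i,
      (gaussianExcess (t * upperSlope (x i) (z i)) +
        gaussianExcess (-(t * lowerSlope (x i) (z i))))) := by
  refine (iInf₂_le (t / lam) (by positivity)).trans (expSqDist_le_of_box_subset
    (fun i => mul_le_mul_of_nonneg_left (lowerSlope_le_upperSlope _ _) ht) fun u hu => ?_)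
  rcases ht.eq_or_lt with rfl | ht
  · -- at level `0` the box is the origin, and only some subgradient is needed
    refine ⟨WithLp.toLp 2 fun i => lam * lowerSlope (x i) (z i), mem_subdifferential_l1l1 hlam
      fun i => ⟨le_rfl, mul_le_mul_of_nonneg_left (lowerSlope_le_upperSlope _ _) hlam.le⟩, ?_⟩
    ext i
    have := hu i
    simp only [zero_mul] at this
    simpa using le_antisymm this.1 this.2
  · have hτ : t / lam ≠ 0 := (div_pos ht hlam).ne'
    rw [Set.mem_smul_set_iff_inv_smul_mem₀ hτ]
    refine mem_subdifferential_l1l1 hlam fun i => ?_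
    have hui : ((t / lam)⁻¹ • u) i = lam / t * u i := by simp
    rw [hui]
    have e : ∀ a : ℝ, lam * a = lam / t * (t * a) := fun a => by field_simp
    rw [e, e (upperSlope _ _)]
    have hpos := (div_pos hlam ht).le
    exact ⟨mul_le_mul_of_nonneg_left (hu i).1 hpos, mul_le_mul_of_nonneg_left (hu i).2 hpos⟩

/-! ### The measurement bound of the `ℓ₁`-`ℓ₁` function -/

/-- The effective sparsity `(‖x‖₀ + ‖x - z‖₀) / 2` of the pair. -/
noncomputable def pairSparsity (x z : Signal n) : ℝ := ((nnz x : ℝ) + nnz (x - z)) / 2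

theorem natCast_nnz (v : Signal n) : (nnz v : ℝ) = ∑ i, if v i = 0 then 0 else 1 := by
  simp [nnz, Finset.sum_ite]

theorem natCast_hbar (x z : Signal n) : (hbar x z : ℝ) =
    ∑ i, if (0 < x i ∧ z i < x i) ∨ (x i < 0 ∧ x i < z i) then 1 else 0 := by
  rw [hbar, ← Finset.filter_or]
  simp

/-- The expected squared distance of a standard normal variable to `t` times the interval of
slopes. It is a sum over the two absolute values: one with a kink at `a` contributes
`E[(γ - t)₊²]`, one that is smooth there contributes `1 / 2`. If the slope is unique and equal to
`± 1`, there is an additional `t²`. -/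
theorem excess_slopes (a b t : ℝ) :
    gaussianExcess (t * upperSlope a b) + gaussianExcess (-(t * lowerSlope a b)) =
      ((if a = 0 then 0 else 1) + (if a - b = 0 then 0 else 1)) / 2 +
      (if (0 < a ∧ b < a) ∨ (a < 0 ∧ a < b) then 1 else 0) * t ^ 2 +
      (1 - ((if a = 0 then 0 else 1) + (if a - b = 0 then 0 else 1)) / 2) *
        (2 * gaussianExcess t) := by
  have h1 := gaussianExcess_add_neg t
  have h0 := gaussianExcess_zero
  unfold upperSlope lowerSlope leftSign rightSign
  -- all the conditions become sign conditions on `a` and on `d = a - b`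
  obtain ⟨d, rfl⟩ : ∃ d, b = a - d := ⟨a - b, by ring⟩
  have hlt : a < a - d ↔ d < 0 := by constructor <;> intro h <;> linarith
  simp only [sub_sub_cancel, sub_lt_self_iff, hlt]
  have trich : ∀ r : ℝ, (r < 0 ∧ ¬ 0 < r ∧ r ≠ 0) ∨ (¬ r < 0 ∧ ¬ 0 < r ∧ r = 0) ∨
      (¬ r < 0 ∧ 0 < r ∧ r ≠ 0) := by
    intro r
    rcases lt_trichotomy r 0 with h | h | h
    · exact Or.inl ⟨h, h.not_gt, h.ne⟩
    · exact Or.inr (Or.inl ⟨h.not_lt, h.not_gt, h⟩)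
    · exact Or.inr (Or.inr ⟨h.not_gt, h, h.ne'⟩)
  rcases trich a with ⟨a1, a2, a3⟩ | ⟨a1, a2, a3⟩ | ⟨a1, a2, a3⟩ <;>
    rcases trich d with ⟨d1, d2, d3⟩ | ⟨d1, d2, d3⟩ | ⟨d1, d2, d3⟩ <;>
    simp only [a1, a2, a3, d1, d2, d3, if_true, if_false, and_self, and_true, and_false, or_false,
      false_or] <;>
    norm_num <;> linarith

theorem sum_excess_slopes (x z : Signal n) (t : ℝ) :
    ∑ i, (gaussianExcess (t * upperSlope (x i) (z i)) +
      gaussianExcess (-(t * lowerSlope (x i) (z i)))) =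
      pairSparsity x z + hbar x z * t ^ 2 + (n - pairSparsity x z) * (2 * gaussianExcess t) := by
  simp_rw [excess_slopes]
  rw [Finset.sum_add_distrib, Finset.sum_add_distrib, ← Finset.sum_mul, ← Finset.sum_mul,
    Finset.sum_sub_distrib, ← Finset.sum_div, Finset.sum_add_distrib, pairSparsity, natCast_nnz,
    natCast_nnz, natCast_hbar]
  simp
  rfl

theorem nnz_le (v : Signal n) : (nnz v : ℝ) ≤ n := by
  exact_mod_cast (Finset.card_filter_le _ _).trans_eq (by simp)

/-- The bound on `U_g`, from the scale `t = √(2 log (n / s))` with `s` the effective sparsity. -/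
theorem measurementU_l1l1_le_bound {lam : ℝ} (hlam : 0 < lam) (x z : Signal n)
    (h : 0 < pairSparsity x z) :
    measurementU (l1l1 lam z) x + 1 ≤ ENNReal.ofReal
      (2 * hbar x z * Real.log (n / pairSparsity x z) + 7 / 5 * pairSparsity x z + 1) := by
  set s := pairSparsity x z with hs
  have hsn : s ≤ n := by
    have := nnz_le x
    have := nnz_le (x - z)
    rw [hs, pairSparsity]; linarith
  have hlog : 0 ≤ Real.log (n / s) := Real.log_nonneg ((one_le_div h).2 hsn)
  have hU := measurementU_l1l1_le hlam x z (Real.sqrt_nonneg (2 * Real.log (n / s)))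
  rw [sum_excess_slopes, ← hs, Real.sq_sqrt (by positivity)] at hU
  rw [ENNReal.ofReal_add (by positivity) zero_le_one, ENNReal.ofReal_one]
  gcongr
  refine hU.trans (ENNReal.ofReal_le_ofReal ?_)
  have := sub_mul_gaussianExcess_le h hsn
  linarith

theorem measurement_conditions {g : Signal n → ℝ} {x : Signal n} {B : ℝ}
    (h : measurementU g x + 1 ≤ ENNReal.ofReal B) :
    measurementU g x + 1 ≤ ENNReal.ofReal B ∧
      ∀ m : ℕ, B ≤ m → measurementU g x + 1 ≤ m ∧ statDim (descentCone g x) + 1 ≤ m := by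
  refine ⟨h, fun m hm => ?_⟩
  have hU : measurementU g x + 1 ≤ m :=
    h.trans ((ENNReal.ofReal_le_ofReal hm).trans_eq (ENNReal.ofReal_natCast m))
  exact ⟨hU, (add_le_add_left (statDim_descentCone_le_measurementU g x) 1).trans hU⟩

variable {J : ℕ}

/-! ### Counting entries of the pair of signals -/

/-- The decomposition `(‖x‖₀ + ‖x - z‖₀) / 2 = s₀ + ξ / 2`: the entries of `x - z` on which the
two counts differ are those counted by `ξ`. -/
theorem pairSparsity_eq_nnz_add_xi (x z : Signal n) :
    pairSparsity x z = nnz x + (xi x z : ℝ) / 2 := by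
  have h1 : ((Finset.univ.filter fun i => z i ≠ x i ∧ x i = 0).card : ℝ) =
      ∑ i, if z i ≠ x i ∧ x i = 0 then 1 else 0 := by simp
  have h2 : ((Finset.univ.filter fun i => z i = x i ∧ x i ≠ 0).card : ℝ) =
      ∑ i, if z i = x i ∧ x i ≠ 0 then 1 else 0 := by simp
  have h : (nnz (x - z) : ℝ) = nnz x + (xi x z : ℝ) := by
    rw [xi]
    push_cast
    rw [h1, h2, natCast_nnz, natCast_nnz, ← Finset.sum_sub_distrib, ← Finset.sum_add_distrib]
    refine Finset.sum_congr rfl fun i _ => ?_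
    have e : (x - z) i = 0 ↔ z i = x i := by
      rw [PiLp.sub_apply, sub_eq_zero, eq_comm]
    simp only [e]
    split_ifs <;> first | (exfalso; tauto) | norm_num
  rw [pairSparsity, h]
  ring

theorem l1l1_zero {lam : ℝ} (v : Signal n) : l1l1 lam 0 v = lam * l1Norm v := by
  simp [l1l1]
  ring

theorem pairSparsity_zero (x : Signal n) : pairSparsity x 0 = nnz x := by
  rw [pairSparsity, sub_zero]
  ring

theorem hbar_zero (x : Signal n) : hbar x 0 = nnz x := by
  rw [hbar, nnz, ← Finset.filter_or]
  congr 1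
  ext i
  simpa using ne_comm

/-! ### The weights `W₀ = I` -/

theorem nL1_of_one {lam : ℝ} {z : Fin (J + 1) → Signal n} (hz : z 0 = 0)
    {W : Fin (J + 1) → Matrix (Fin n) (Fin n) ℝ} (h0 : W 0 = 1) (hW : ∀ j, j ≠ 0 → W j = 0)
    (v : Signal n) : nL1 lam W z v = lam * l1Norm v := by
  rw [nL1, Fintype.sum_eq_single 0 fun j hj => by simp [hW j hj, l1Norm]]
  simp [h0, hz, l1Norm]

theorem firstGroup_of_one {x : Signal n} {z : Fin (J + 1) → Signal n} (hz : z 0 = 0)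
    {W : Fin (J + 1) → Matrix (Fin n) (Fin n) ℝ} (h0 : W 0 = 1) (hW : ∀ j, j ≠ 0 → W j = 0) :
    firstGroup W x z = Finset.univ.filter fun i => x i ≠ 0 := by
  refine Finset.filter_congr fun i _ => ⟨fun h => by simpa [hz] using h 0 (by simp [h0]),
    fun h j hj => ?_⟩
  obtain rfl : j = 0 := by
    by_contra hne
    simp [hW j hne] at hj
  simpa [hz] using h

theorem middleGroup_of_one {x : Signal n} {z : Fin (J + 1) → Signal n}
    {W : Fin (J + 1) → Matrix (Fin n) (Fin n) ℝ} (hW : ∀ j, j ≠ 0 → W j = 0) :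
    middleGroup W x z = ∅ := by
  refine Finset.filter_eq_empty_iff.2 fun i _ => ?_
  rintro ⟨⟨j, hj, hxj⟩, k, hk, hxk⟩
  have key : ∀ j, W j i i ≠ 0 → j = 0 := fun j hj => by
    by_contra hne
    simp [hW j hne] at hj
  rw [key j hj] at hxj
  rw [key k hk] at hxk
  exact hxk hxj

theorem sBar_of_one {x : Signal n} {z : Fin (J + 1) → Signal n} (hz : z 0 = 0)
    {W : Fin (J + 1) → Matrix (Fin n) (Fin n) ℝ} (h0 : W 0 = 1) (hW : ∀ j, j ≠ 0 → W j = 0) :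
    sBar W x z = nnz x := by
  rw [sBar, middleGroup_of_one hW, firstGroup_of_one hz h0 hW, nnz]
  simp

theorem delta_of_one {x : Signal n} {z : Fin (J + 1) → Signal n}
    {W : Fin (J + 1) → Matrix (Fin n) (Fin n) ℝ} (hW : ∀ j, j ≠ 0 → W j = 0) :
    delta W x z = 0 := by
  rw [delta, sBar, middleGroup_of_one hW]
  simp

theorem aBar_of_one {x : Signal n} {z : Fin (J + 1) → Signal n} (hz : z 0 = 0)
    {W : Fin (J + 1) → Matrix (Fin n) (Fin n) ℝ} (h0 : W 0 = 1) (hW : ∀ j, j ≠ 0 → W j = 0) :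
    aBar W x z = nnz x := by
  have h : ∀ i ∈ firstGroup W x z, aCoef W x z i ^ 2 = 1 := by
    intro i hi
    rw [firstGroup_of_one hz h0 hW, Finset.mem_filter] at hi
    rw [aCoef, Fintype.sum_eq_single 0 fun j hj => by simp [hW j hj]]
    rcases lt_or_gt_of_ne hi.2 with hx | hx
    · simp [h0, hz, Real.sign_of_neg hx]
    · simp [h0, hz, Real.sign_of_pos hx]
  rw [aBar, Finset.sum_congr rfl h, firstGroup_of_one hz h0 hW, nnz]
  simp

/-! ### The weights `W₀ = W₁ = I / 2` -/

section Halves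

variable {lam : ℝ} {x : Signal n} {z : Fin (J + 1) → Signal n}
  {W : Fin (J + 1) → Matrix (Fin n) (Fin n) ℝ}

theorem zero_ne_one_of_one_le (hJ : 1 ≤ J) : (0 : Fin (J + 1)) ≠ 1 := by
  obtain ⟨k, rfl⟩ := Nat.exists_eq_add_of_le' hJ
  exact Fin.zero_ne_one

theorem nL1_of_halves (hJ : 1 ≤ J) (hz : z 0 = 0) (h0 : W 0 = (1 / 2 : ℝ) • 1)
    (h1 : W 1 = (1 / 2 : ℝ) • 1) (hW : ∀ j, j ≠ 0 → j ≠ 1 → W j = 0) (v : Signal n) :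
    nL1 lam W z v = lam / 2 * (l1Norm v + l1Norm (v - z 1)) := by
  rw [nL1, Fintype.sum_eq_add 0 1 (zero_ne_one_of_one_le hJ)
    fun j hj => by simp [hW j hj.1 hj.2, l1Norm]]
  simp [h0, h1, hz, l1Norm, Matrix.smul_mulVec, abs_mul, ← Finset.mul_sum]
  ring

theorem weight_ne_zero_iff (h0 : W 0 = (1 / 2 : ℝ) • 1)
    (h1 : W 1 = (1 / 2 : ℝ) • 1) (hW : ∀ j, j ≠ 0 → j ≠ 1 → W j = 0) (i : Fin n)
    (j : Fin (J + 1)) : W j i i ≠ 0 ↔ j = 0 ∨ j = 1 := by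
  constructor
  · intro h
    by_contra! hne
    simp [hW j hne.1 hne.2] at h
  · rintro (rfl | rfl)
    · simp [h0]
    · simp [h1]

theorem mem_firstGroup_of_halves (hz : z 0 = 0) (h0 : W 0 = (1 / 2 : ℝ) • 1)
    (h1 : W 1 = (1 / 2 : ℝ) • 1) (hW : ∀ j, j ≠ 0 → j ≠ 1 → W j = 0) (i : Fin n) :
    i ∈ firstGroup W x z ↔ x i ≠ 0 ∧ x i ≠ z 1 i := by
  simp only [firstGroup, Finset.mem_filter, Finset.mem_univ, true_and,
    weight_ne_zero_iff h0 h1 hW]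
  simp [or_imp, forall_and, hz]

theorem mem_middleGroup_of_halves (hz : z 0 = 0) (h0 : W 0 = (1 / 2 : ℝ) • 1)
    (h1 : W 1 = (1 / 2 : ℝ) • 1) (hW : ∀ j, j ≠ 0 → j ≠ 1 → W j = 0) (i : Fin n) :
    i ∈ middleGroup W x z ↔ (x i = 0 ∨ x i = z 1 i) ∧ (x i ≠ 0 ∨ x i ≠ z 1 i) := by
  simp only [middleGroup, Finset.mem_filter, Finset.mem_univ, true_and,
    weight_ne_zero_iff h0 h1 hW]
  simp [or_and_right, exists_or, hz]

theorem aCoef_of_halves (hJ : 1 ≤ J) (hz : z 0 = 0) (h0 : W 0 = (1 / 2 : ℝ) • 1)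
    (h1 : W 1 = (1 / 2 : ℝ) • 1) (hW : ∀ j, j ≠ 0 → j ≠ 1 → W j = 0) (i : Fin n) :
    aCoef W x z i = (Real.sign (x i) + Real.sign (x i - z 1 i)) / 2 := by
  rw [aCoef, Fintype.sum_eq_add 0 1 (zero_ne_one_of_one_le hJ)
    fun j hj => by simp [hW j hj.1 hj.2]]
  simp [h0, h1, hz]
  ring

theorem cCoef_of_halves (hJ : 1 ≤ J) (hz : z 0 = 0) (h0 : W 0 = (1 / 2 : ℝ) • 1)
    (h1 : W 1 = (1 / 2 : ℝ) • 1) (hW : ∀ j, j ≠ 0 → j ≠ 1 → W j = 0) (i : Fin n) :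
    cCoef W x z i = (if x i = 0 then 1 / 2 else 0) + if x i = z 1 i then 1 / 2 else 0 := by
  rw [cCoef, Fintype.sum_eq_add 0 1 (zero_ne_one_of_one_le hJ)
    fun j hj => by simp [hW j hj.1 hj.2]]
  simp [h0, h1, hz]

/-- On the first group the two signs either agree, which happens exactly on the set counted by
`h̄`, or cancel. -/
theorem aBar_of_halves (hJ : 1 ≤ J) (hz : z 0 = 0) (h0 : W 0 = (1 / 2 : ℝ) • 1)
    (h1 : W 1 = (1 / 2 : ℝ) • 1) (hW : ∀ j, j ≠ 0 → j ≠ 1 → W j = 0) :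
    aBar W x z = hbar x (z 1) := by
  rw [aBar, natCast_hbar]
  refine (Finset.sum_congr rfl fun i hi => ?_).trans
    (Finset.sum_subset (Finset.subset_univ (firstGroup W x z)) fun i _ hi => ?_)
  · rw [mem_firstGroup_of_halves hz h0 h1 hW] at hi
    rw [aCoef_of_halves hJ hz h0 h1 hW]
    rcases lt_or_gt_of_ne hi.1 with a | a <;> rcases lt_or_gt_of_ne hi.2 with b | b
    · rw [Real.sign_of_neg a, Real.sign_of_neg (sub_neg.2 b), if_pos (Or.inr ⟨a, b⟩)]; norm_num
    · rw [Real.sign_of_neg a, Real.sign_of_pos (sub_pos.2 b), if_neg (by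
        rintro (h | h) <;> linarith [h.1, h.2])]; norm_num
    · rw [Real.sign_of_pos a, Real.sign_of_neg (sub_neg.2 b), if_neg (by
        rintro (h | h) <;> linarith [h.1, h.2])]; norm_num
    · rw [Real.sign_of_pos a, Real.sign_of_pos (sub_pos.2 b), if_pos (Or.inl ⟨a, b⟩)]; norm_num
  · rw [mem_firstGroup_of_halves hz h0 h1 hW] at hi
    refine if_neg fun h => hi ?_
    rcases h with h | h
    · exact ⟨h.1.ne', h.2.ne'⟩
    · exact ⟨h.1.ne, h.2.ne⟩

theorem sBar_of_halves (hJ : 1 ≤ J) (hz : z 0 = 0) (h0 : W 0 = (1 / 2 : ℝ) • 1)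
    (h1 : W 1 = (1 / 2 : ℝ) • 1) (hW : ∀ j, j ≠ 0 → j ≠ 1 → W j = 0) :
    sBar W x z = pairSparsity x (z 1) := by
  have hP : ((firstGroup W x z).card : ℝ) = ∑ i, if x i ≠ 0 ∧ x i ≠ z 1 i then 1 else 0 := by
    rw [Finset.sum_boole]
    congr 2
    ext i
    simp [mem_firstGroup_of_halves hz h0 h1 hW]
  have hM : ∑ i ∈ middleGroup W x z, (1 - cCoef W x z i) =
      ∑ i, if (x i = 0 ∨ x i = z 1 i) ∧ (x i ≠ 0 ∨ x i ≠ z 1 i) then 1 - cCoef W x z i else 0 := by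
    rw [← Finset.sum_filter]
    congr 1
    ext i
    simp only [mem_middleGroup_of_halves hz h0 h1 hW, Finset.mem_filter, Finset.mem_univ, true_and]
  rw [sBar, hP, hM, pairSparsity, natCast_nnz, natCast_nnz, ← Finset.sum_add_distrib,
    ← Finset.sum_add_distrib, Finset.sum_div]
  refine Finset.sum_congr rfl fun i _ => ?_
  rw [cCoef_of_halves hJ hz h0 h1 hW]
  simp only [PiLp.sub_apply, sub_eq_zero]
  split_ifs <;> first | (exfalso; tauto) | norm_num

end Halves

end NL1

theorem corollary1 (n J : ℕ) (lam : ℝ) (hlam : 0 < lam)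
    (x : Signal n) (z : Fin (J + 1) → Signal n) (hz : z 0 = 0)
    (W : Fin (J + 1) → Matrix (Fin n) (Fin n) ℝ) :
    -- (a) the weights `W₀ = I`, `W_j = 0` for `j ≥ 1`
    (W 0 = 1 → (∀ j, j ≠ 0 → W j = 0) → 0 < nnz x →
      (∀ v : Signal n, nL1 lam W z v = lam * l1Norm v) ∧
      aBar W x z = nnz x ∧ sBar W x z = nnz x ∧ delta W x z = 0 ∧
      nL1Bound W x z = l1Bound x ∧
      measurementU (nL1 lam W z) x + 1 ≤ ENNReal.ofReal (l1Bound x) ∧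
      ∀ m : ℕ, l1Bound x ≤ m →
        measurementU (nL1 lam W z) x + 1 ≤ m ∧
        statDim (descentCone (nL1 lam W z) x) + 1 ≤ m) ∧
    -- (b) the weights `W₀ = W₁ = I / 2`, `W_j = 0` for `j ≥ 2`
    (1 ≤ J → W 0 = (1 / 2 : ℝ) • 1 → W 1 = (1 / 2 : ℝ) • 1 →
      (∀ j, j ≠ 0 → j ≠ 1 → W j = 0) → 0 < nnz x + nnz (x - z 1) →
      (∀ v : Signal n, nL1 lam W z v = lam / 2 * (l1Norm v + l1Norm (v - z 1))) ∧
      aBar W x z = hbar x (z 1) ∧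
      sBar W x z = ((nnz x : ℝ) + nnz (x - z 1)) / 2 ∧
      ((nnz x : ℝ) + nnz (x - z 1)) / 2 = nnz x + (xi x (z 1) : ℝ) / 2 ∧
      l1l1Bound x (z 1) = 2 * aBar W x z * Real.log (n / sBar W x z) + 7 / 5 * sBar W x z + 1 ∧
      measurementU (nL1 lam W z) x + 1 ≤ ENNReal.ofReal (l1l1Bound x (z 1)) ∧
      ∀ m : ℕ, l1l1Bound x (z 1) ≤ m →
        measurementU (nL1 lam W z) x + 1 ≤ m ∧
        statDim (descentCone (nL1 lam W z) x) + 1 ≤ m) := by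
  constructor
  · intro h0 hW hx
    have ha := aBar_of_one (x := x) hz h0 hW
    have hs := sBar_of_one (x := x) hz h0 hW
    have hd := delta_of_one (x := x) (z := z) hW
    refine ⟨nL1_of_one hz h0 hW, ha, hs, hd, ?_, measurement_conditions ?_⟩
    · rw [nL1Bound, ha, hs, hd, add_zero, l1Bound]
    · -- the `ℓ₁` function is the `ℓ₁`-`ℓ₁` function with side information `0`
      have hg : nL1 lam W z = l1l1 lam 0 :=
        funext fun v => (nL1_of_one hz h0 hW v).trans (l1l1_zero v).symm
      have h := measurementU_l1l1_le_bound hlam x 0 (by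
        rw [pairSparsity_zero]; exact_mod_cast hx)
      rwa [pairSparsity_zero, hbar_zero, ← hg] at h
  · intro hJ h0 h1 hW hx
    have ha := aBar_of_halves (x := x) hJ hz h0 h1 hW
    have hs := sBar_of_halves (x := x) hJ hz h0 h1 hW
    have hxi := pairSparsity_eq_nnz_add_xi x (z 1)
    have hB : l1l1Bound x (z 1) = 2 * hbar x (z 1) * Real.log (n / pairSparsity x (z 1)) +
        7 / 5 * pairSparsity x (z 1) + 1 := by
      rw [l1l1Bound, hxi]
    refine ⟨nL1_of_halves hJ hz h0 h1 hW, ha, hs, hxi, by rw [ha, hs, hB],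
      measurement_conditions ?_⟩
    have hg : nL1 lam W z = l1l1 lam (z 1) := funext (nL1_of_halves hJ hz h0 h1 hW)
    have hpos : (0 : ℝ) < (nnz x : ℝ) + nnz (x - z 1) := by exact_mod_cast hx
    rw [hB, hg]
    exact measurementU_l1l1_le_bound hlam x (z 1) (half_pos hpos)
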